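/- Let $(W_t)_{t\ge 0}$ be a standard Wiener process on a probability space $(\Omega,\mathcal F,\mathbf P)$, let $\sigma>0$ and $0<v\le 1$, and put $$\tilde\eta_v=\int_0^v \exp\{\sigma W_u-\sigma^2u/2\}\,du .$$ For $a\in\mathbb R$ let $B^a_u=W_u-uW_1+ua$ $(0\le u\le 1)$ be the Brownian bridge from $0$ to $a$, and let $$F(v,a)=\int_0^v\exp\{\sigma B^a_u-\sigma^2u/2\}\,du,\qquad K(v,a)=\sigma\int_0^v u\exp\{\sigma B^a_u-\sigma^2u/2\}\,du .$$ Let $\varphi$ be the density of $\mathcal N(0,1)$. Then: 1. The random variable $\tilde\eta_v$ has a density with respect to Lebesgue measure. 2. For almost every $a\in\mathbb{R}$ (with respect to the law of $W_1$), the conditional distribution of $\tilde\eta_v$ given $W_1=a$ is the law of $F(v,a)$. 3. Almost surely, for all $a\in\mathbb R$, the function $F(v,\cdot)$ is differentiable at $a$ with $\partial_aF(v,a)=K(v,a)>0$; and almost surely, for every $z>0$, the equation $F(v,a)=z$ has exactly one solution $a=a(v,z)\in\mathbb R$. 4. For every $z>0$ the random variable $\varphi(a(v,z))/K(v,a(v,z))$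 is integrable, and the density of $\tilde\eta_v$ is, for almost every $z$, given by $$q(v,z)=\mathbf E\left[\frac{\varphi(a(v,z))}{K(v,a(v,z))}\right]\quad (z>0),\qquad q(v,z)=0\quad (z\le 0).$$ -/

import Mathlib

open MeasureTheory ProbabilityTheory
open scoped NNReal ENNReal

noncomputable section

namespace AsianOption

variable {Ω : Type*}

/-- The random variable `∫₀ᵛ exp (σ W_u - σ² u / 2) du`. -/
def expFunctional (σ : ℝ) (W : ℝ≥0 → Ω → ℝ) (v : ℝ) (ω : Ω) : ℝ :=
  ∫ u in (0 : ℝ)..v, Real.exp (σ * W u.toNNReal ω - σ ^ 2 * u / 2)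

/-- The Brownian bridge `B_t^a = W_t - t W_1 + t a` (for `0 ≤ t ≤ 1`), which goes
from `0` at time `0` to `a` at time `1`. -/
def bridge (W : ℝ≥0 → Ω → ℝ) (a : ℝ) (t : ℝ≥0) (ω : Ω) : ℝ :=
  W t ω - t * W 1 ω + t * a

/-- `F(v, a) = ∫₀ᵛ exp (σ B_u^a - σ² u / 2) du`, a random function of `a`. -/
def bridgeF (σ : ℝ) (W : ℝ≥0 → Ω → ℝ) (v a : ℝ) (ω : Ω) : ℝ :=
  ∫ u in (0 : ℝ)..v, Real.exp (σ * bridge W a u.toNNReal ω - σ ^ 2 * u / 2)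

/-- `K(v, a) = σ ∫₀ᵛ u exp (σ B_u^a - σ² u / 2) du`. -/
def bridgeK (σ : ℝ) (W : ℝ≥0 → Ω → ℝ) (v a : ℝ) (ω : Ω) : ℝ :=
  σ * ∫ u in (0 : ℝ)..v, u * Real.exp (σ * bridge W a u.toNNReal ω - σ ^ 2 * u / 2)

/-- The implicit function `a(v, z)`: a solution `a` of `F(v, a) = z` (an arbitrary value
if there is no solution). -/
def implicitA (σ : ℝ) (W : ℝ≥0 → Ω → ℝ) (v z : ℝ) (ω : Ω) : ℝ :=
  Function.invFun (fun a : ℝ => bridgeF σ W v a ω) z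

/-- The random variable `φ(a(v, z)) / K(v, a(v, z))`, with `φ` the density of `N(0, 1)`. -/
def densityIntegrand (σ : ℝ) (W : ℝ≥0 → Ω → ℝ) (v z : ℝ) (ω : Ω) : ℝ :=
  gaussianPDFReal 0 1 (implicitA σ W v z ω) / bridgeK σ W v (implicitA σ W v z ω) ω

/-- `q(v, z) = E[φ(a(v, z)) / K(v, a(v, z))]`. -/
def densityQ [MeasurableSpace Ω] (P : Measure Ω) (σ : ℝ) (W : ℝ≥0 → Ω → ℝ) (v z : ℝ) : ℝ :=
  ∫ ω, densityIntegrand σ W v z ω ∂P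

end AsianOption

end

/-! Write `W_u = Z_u + u W_1` with `Z_u = W_u - u W_1`. Then the functional is `F(v, W_1)`, where
the random function `F(v, ·)` depends on `Z` alone. The pair `(W_1, Z)` is jointly Gaussian and
uncorrelated, hence independent (`indepFun_eval_one_bridgePath`), so conditioning on `W_1 = a`
amounts to freezing the endpoint.

For a fixed continuous path, `F(v, ·)` has derivative `K > 0` and maps `ℝ` bijectively onto `(0,
∞)`. Given `Z`, the substitution `z = F(v, a)` in the Gaussian integral (`setLIntegral_pathF`)
produces the density `φ/K` at `a(v, z)`; Tonelli averages it over `Z` (`map_pathF_eq_withDensity`).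

The delicate point is finiteness of the expectation for every `z`, since `K` may be small. With `f`
the integrand of `F`, `pow_three_le_mul_pathK` gives `K ≥ σ z³ / (4 ∫ f²)`. The integral `∫ f²`
grows at most like `exp (2σ|a|)`, which `φ(a)` absorbs, leaving a bound free of `a(v, z)` and
integrable by Gaussian exponential moments. -/

namespace AsianOption

section

open Filter Topology

section

/-! ### Exponential functionals along a fixed continuous path -/

/-- The integrand `exp (σ (b u + u a) - σ² u / 2)` along a path `b`. -/
noncomputable def pathIntegrand (σ : ℝ) (b : ℝ → ℝ) (a u : ℝ) : ℝ :=
  Real.exp (σ * (b u + u * a) - σ ^ 2 * u / 2)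

/-- The integral of `pathIntegrand` over `[0, v]`. -/
noncomputable def pathF (σ : ℝ) (b : ℝ → ℝ) (v a : ℝ) : ℝ :=
  ∫ u in (0 : ℝ)..v, pathIntegrand σ b a u

/-- The derivative of `pathF` in the endpoint `a`. -/
noncomputable def pathK (σ : ℝ) (b : ℝ → ℝ) (v a : ℝ) : ℝ :=
  σ * ∫ u in (0 : ℝ)..v, u * pathIntegrand σ b a u

variable {σ v : ℝ} {b : ℝ → ℝ}

lemma pathIntegrand_pos (σ : ℝ) (b : ℝ → ℝ) (a u : ℝ) : 0 < pathIntegrand σ b a u :=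
  Real.exp_pos _

lemma continuous_pathIntegrand (hb : Continuous b) (a : ℝ) :
    Continuous (pathIntegrand σ b a) := by
  unfold pathIntegrand
  fun_prop

lemma hasDerivAt_pathIntegrand (σ : ℝ) (b : ℝ → ℝ) (a u : ℝ) :
    HasDerivAt (fun x ↦ pathIntegrand σ b x u) (σ * (u * pathIntegrand σ b a u)) a := by
  unfold pathIntegrand
  have h : HasDerivAt (fun x ↦ σ * (b u + u * x) - σ ^ 2 * u / 2) (σ * (u * 1)) a :=
    ((((hasDerivAt_id a).const_mul u).const_add (b u)).const_mul σ).sub_const _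
  convert h.exp using 1
  ring

lemma monotone_pathIntegrand (hσ : 0 ≤ σ) {u : ℝ} (hu : 0 ≤ u) :
    Monotone (fun a ↦ pathIntegrand σ b a u) := by
  intro a a' h
  unfold pathIntegrand
  have : σ * (b u + u * a) ≤ σ * (b u + u * a') := by gcongr
  exact Real.exp_le_exp.2 (by linarith)

lemma hasDerivAt_pathF (hσ : 0 < σ) (hv : 0 < v) (hb : Continuous b) (a : ℝ) :
    HasDerivAt (pathF σ b v) (pathK σ b v a) a := by
  have hc := fun x ↦ continuous_pathIntegrand (σ := σ) hb x
  have h := (intervalIntegral.hasDerivAt_integral_of_dominated_loc_of_deriv_le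
    (μ := volume) (a := 0) (b := v) (F := fun x u ↦ pathIntegrand σ b x u)
    (F' := fun x u ↦ σ * (u * pathIntegrand σ b x u)) (x₀ := a)
    -- For `u ≥ 0` the integrand increases in the endpoint, so its value at `a + 1` dominates on the
    -- unit ball around `a`.
    (bound := fun u ↦ σ * (u * pathIntegrand σ b (a + 1) u)) (s := Metric.ball a 1)
    (Metric.ball_mem_nhds a one_pos)
    (Eventually.of_forall fun x ↦ (hc x).aestronglyMeasurable)
    ((hc a).intervalIntegrable _ _)
    (by have := hc a; exact Continuous.aestronglyMeasurable (by fun_prop))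
    (ae_of_all _ fun u hu x hx ↦ ?_)
    (by have := hc (a + 1); exact Continuous.intervalIntegrable (by fun_prop) _ _)
    (ae_of_all _ fun u _ x _ ↦ hasDerivAt_pathIntegrand σ b x u)).2
  · rw [intervalIntegral.integral_const_mul] at h
    exact h
  · rw [Set.uIoc_of_le hv.le] at hu
    have hu0 := hu.1.le
    have hx' : x ≤ a + 1 := by
      rw [Metric.mem_ball, Real.dist_eq, abs_lt] at hx
      linarith
    rw [Real.norm_of_nonneg (mul_nonneg hσ.le (mul_nonneg hu0 (pathIntegrand_pos _ _ _ _).le))]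
    have := monotone_pathIntegrand (b := b) hσ.le hu0 hx'
    gcongr

lemma pathK_pos (hσ : 0 < σ) (hv : 0 < v) (hb : Continuous b) (a : ℝ) : 0 < pathK σ b v a := by
  have := continuous_pathIntegrand (σ := σ) hb a
  refine mul_pos hσ (intervalIntegral.intervalIntegral_pos_of_pos_on
    (Continuous.intervalIntegrable (by fun_prop) _ _) (fun u hu ↦ ?_) hv)
  exact mul_pos hu.1 (pathIntegrand_pos _ _ _ _)

lemma pathF_pos (hv : 0 < v) (hb : Continuous b) (a : ℝ) : 0 < pathF σ b v a :=
  intervalIntegral.intervalIntegral_pos_of_pos_on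
    ((continuous_pathIntegrand hb a).intervalIntegrable _ _)
    (fun _ _ ↦ pathIntegrand_pos _ _ _ _) hv

lemma continuous_pathF (hσ : 0 < σ) (hv : 0 < v) (hb : Continuous b) :
    Continuous (pathF σ b v) :=
  continuous_iff_continuousAt.2 fun a ↦ (hasDerivAt_pathF hσ hv hb a).continuousAt

lemma strictMono_pathF (hσ : 0 < σ) (hv : 0 < v) (hb : Continuous b) :
    StrictMono (pathF σ b v) :=
  strictMono_of_hasDerivAt_pos (fun a ↦ hasDerivAt_pathF hσ hv hb a)
    fun a ↦ pathK_pos hσ hv hb a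

lemma tendsto_pathF_atBot (hσ : 0 < σ) (hv : 0 < v) (hb : Continuous b) :
    Tendsto (pathF σ b v) atBot (𝓝 0) := by
  have h := intervalIntegral.tendsto_integral_filter_of_dominated_convergence
    (μ := volume) (a := 0) (b := v) (l := atBot) (F := fun x u ↦ pathIntegrand σ b x u)
    (f := fun _ ↦ 0) (pathIntegrand σ b 0)
    (Eventually.of_forall fun x ↦ (continuous_pathIntegrand hb x).aestronglyMeasurable)
    ?_ ((continuous_pathIntegrand hb 0).intervalIntegrable _ _) ?_
  · rw [intervalIntegral.integral_zero] at h
    exact h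
  · filter_upwards [eventually_le_atBot 0] with x hx
    refine ae_of_all _ fun u hu ↦ ?_
    rw [Set.uIoc_of_le hv.le] at hu
    rw [Real.norm_of_nonneg (pathIntegrand_pos _ _ _ _).le]
    exact monotone_pathIntegrand hσ.le hu.1.le hx
  · refine ae_of_all _ fun u hu ↦ ?_
    rw [Set.uIoc_of_le hv.le] at hu
    refine Real.tendsto_exp_atBot.comp ?_
    refine tendsto_atBot_add_const_right _ _ (Tendsto.const_mul_atBot hσ ?_)
    exact tendsto_atBot_add_const_left _ _ (Tendsto.const_mul_atBot hu.1 tendsto_id)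

/-- The integrand is convex in the endpoint, hence lies above its tangent at `0`, by `1 + x ≤ exp
x`. This forces linear growth at `+∞`. -/
lemma add_mul_pathK_le_pathF (hv : 0 < v) (hb : Continuous b) (a : ℝ) :
    pathF σ b v 0 + a * pathK σ b v 0 ≤ pathF σ b v a := by
  have h0 := continuous_pathIntegrand (σ := σ) hb 0
  have ha := continuous_pathIntegrand (σ := σ) hb a
  unfold pathK pathF
  rw [← mul_assoc, ← intervalIntegral.integral_const_mul, ← intervalIntegral.integral_add]
  rotate_left
  · exact Continuous.intervalIntegrable (by fun_prop) _ _
  · exact Continuous.intervalIntegrable (by fun_prop) _ _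
  refine intervalIntegral.integral_mono_on hv.le
    (Continuous.intervalIntegrable (by fun_prop) _ _)
    (Continuous.intervalIntegrable (by fun_prop) _ _) fun u _ ↦ ?_
  have h1 : pathIntegrand σ b a u = pathIntegrand σ b 0 u * Real.exp (σ * u * a) := by
    unfold pathIntegrand
    rw [← Real.exp_add]
    ring_nf
  rw [h1]
  have h2 := Real.add_one_le_exp (σ * u * a)
  have h3 := mul_le_mul_of_nonneg_left h2 (pathIntegrand_pos σ b 0 u).le
  linarith

lemma tendsto_pathF_atTop (hσ : 0 < σ) (hv : 0 < v) (hb : Continuous b) :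
    Tendsto (pathF σ b v) atTop atTop :=
  tendsto_atTop_mono (fun a ↦ add_mul_pathK_le_pathF hv hb a)
    (tendsto_atTop_add_const_left _ _
      (Tendsto.atTop_mul_const (pathK_pos hσ hv hb 0) tendsto_id))

lemma range_pathF (hσ : 0 < σ) (hv : 0 < v) (hb : Continuous b) :
    Set.range (pathF σ b v) = Set.Ioi 0 := by
  refine Set.Subset.antisymm (Set.range_subset_iff.2 fun a ↦ pathF_pos hv hb a) fun z hz ↦ ?_
  exact mem_range_of_exists_le_of_exists_ge (continuous_pathF hσ hv hb)
    (((tendsto_pathF_atBot hσ hv hb).eventually (gt_mem_nhds hz)).exists.imp fun _ h ↦ h.le)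
    ((tendsto_pathF_atTop hσ hv hb).eventually_ge_atTop z).exists

/-- The solution `a` of `pathF σ b v a = z`. -/
noncomputable def pathA (σ : ℝ) (b : ℝ → ℝ) (v z : ℝ) : ℝ := Function.invFun (pathF σ b v) z

lemma pathF_pathA (hσ : 0 < σ) (hv : 0 < v) (hb : Continuous b) {z : ℝ} (hz : 0 < z) :
    pathF σ b v (pathA σ b v z) = z :=
  Function.invFun_eq (by
    have : z ∈ Set.range (pathF σ b v) := by rw [range_pathF hσ hv hb]; exact hz
    exact this)

lemma pathF_eq_iff (hσ : 0 < σ) (hv : 0 < v) (hb : Continuous b) {z : ℝ} (hz : 0 < z) (a : ℝ) :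
    pathF σ b v a = z ↔ a = pathA σ b v z := by
  rw [← (strictMono_pathF hσ hv hb).injective.eq_iff (b := pathA σ b v z),
    pathF_pathA hσ hv hb hz]

lemma pathA_pathF (hσ : 0 < σ) (hv : 0 < v) (hb : Continuous b) (a : ℝ) :
    pathA σ b v (pathF σ b v a) = a :=
  Function.leftInverse_invFun (strictMono_pathF hσ hv hb).injective a

/-- Expresses sublevel sets of the inverse through `pathF`, which makes the inverse measurable in
`(z, ω)`. -/
lemma pathA_le_iff (hσ : 0 < σ) (hv : 0 < v) (hb : Continuous b) {z : ℝ} (hz : 0 < z) (c : ℝ) :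
    pathA σ b v z ≤ c ↔ z ≤ pathF σ b v c := by
  rw [← (strictMono_pathF hσ hv hb).le_iff_le, pathF_pathA hσ hv hb hz]

/-- Change of variables `z = pathF σ b v a`. -/
lemma setLIntegral_pathF (hσ : 0 < σ) (hv : 0 < v) (hb : Continuous b) (f : ℝ → ℝ)
    (g : ℝ → ℝ≥0∞) :
    ∫⁻ a, ENNReal.ofReal (f a) * g (pathF σ b v a) =
      ∫⁻ z in Set.Ioi (0 : ℝ),
        ENNReal.ofReal (f (pathA σ b v z) / pathK σ b v (pathA σ b v z)) * g z := by
  have h := lintegral_image_eq_lintegral_abs_deriv_mul (f := pathF σ b v) (f' := pathK σ b v)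
    MeasurableSet.univ (fun x _ ↦ (hasDerivAt_pathF hσ hv hb x).hasDerivWithinAt)
    (strictMono_pathF hσ hv hb).injective.injOn
    (fun z ↦ ENNReal.ofReal (f (pathA σ b v z) / pathK σ b v (pathA σ b v z)) * g z)
  rw [Set.image_univ, range_pathF hσ hv hb] at h
  rw [h, Measure.restrict_univ]
  refine lintegral_congr fun a ↦ ?_
  have hK := pathK_pos hσ hv hb a
  rw [pathA_pathF hσ hv hb, ← mul_assoc, ← ENNReal.ofReal_mul (abs_nonneg _), abs_of_pos hK,
    mul_div_cancel₀ _ hK.ne']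

/-- A function with given integral `z` can make `∫ u f` small only by concentrating near `u = 0`,
which costs a large `∫ f²`. Quantitatively, `f ≤ α u f + f exp (-α u)`, and Young's inequality with
weight `δ` splits the last product. -/
lemma pow_three_le_mul_pathK (hσ : 0 < σ) (hv : 0 < v) (hb : Continuous b) (a : ℝ) :
    pathF σ b v a ^ 3 * σ ≤ 4 * (∫ u in (0 : ℝ)..v, pathIntegrand σ b a u ^ 2) * pathK σ b v a := by
  have hc := continuous_pathIntegrand (σ := σ) hb a
  have hz := pathF_pos (σ := σ) hv hb a
  set z := pathF σ b v a with hz_def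
  set S := ∫ u in (0 : ℝ)..v, pathIntegrand σ b a u ^ 2 with hS_def
  set L := ∫ u in (0 : ℝ)..v, u * pathIntegrand σ b a u with hL_def
  have hS : 0 < S := intervalIntegral.intervalIntegral_pos_of_pos_on
    (Continuous.intervalIntegrable (by fun_prop) _ _)
    (fun u _ ↦ pow_pos (pathIntegrand_pos σ b a u) 2) hv
  -- Chosen so that the two error terms `δ S / 2` and `1 / (4 δ α)` both equal `z / 4`, leaving `z /
  -- 2 ≤ α L`.
  set δ := z / (2 * S) with hδ_def
  set α := 2 * S / z ^ 2 with hα_def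
  have hδ : 0 < δ := by positivity
  have hα : 0 < α := by positivity
  have hexp : ∫ u in (0 : ℝ)..v, Real.exp (-(2 * α) * u) ≤ 1 / (2 * α) := by
    rw [intervalIntegral.integral_comp_mul_left (fun x ↦ Real.exp x) (by linarith), integral_exp,
      mul_zero, Real.exp_zero, smul_eq_mul, inv_neg, neg_mul, ← mul_neg, neg_sub, ← one_div]
    have := Real.exp_pos (-(2 * α) * v)
    exact mul_le_of_le_one_right (by positivity) (by linarith)
  have key : z ≤ ∫ u in (0 : ℝ)..v, (α * (u * pathIntegrand σ b a u) +
      δ / 2 * pathIntegrand σ b a u ^ 2 + 1 / (2 * δ) * Real.exp (-(2 * α) * u)) := by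
    refine intervalIntegral.integral_mono_on hv.le
      (Continuous.intervalIntegrable (by fun_prop) _ _)
      (Continuous.intervalIntegrable (by fun_prop) _ _) fun u _ ↦ ?_
    set f := pathIntegrand σ b a u
    have hf : 0 < f := pathIntegrand_pos σ b a u
    have h1 : f * (1 - α * u) ≤ f * Real.exp (-(α * u)) := by
      have := Real.add_one_le_exp (-(α * u))
      gcongr
      linarith
    have h2 : Real.exp (-(2 * α) * u) = Real.exp (-(α * u)) ^ 2 := by
      rw [← Real.exp_nat_mul]
      push_cast
      ring_nf
    rw [h2]
    set e := Real.exp (-(α * u))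
    have h3 : f * e ≤ δ / 2 * f ^ 2 + 1 / (2 * δ) * e ^ 2 := by
      have : δ / 2 * f ^ 2 + 1 / (2 * δ) * e ^ 2 - f * e = (δ * f - e) ^ 2 / (2 * δ) := by
        field_simp
        ring
      have h4 : 0 ≤ (δ * f - e) ^ 2 / (2 * δ) := by positivity
      linarith
    linarith
  rw [intervalIntegral.integral_add (Continuous.intervalIntegrable (by fun_prop) _ _)
      (Continuous.intervalIntegrable (by fun_prop) _ _),
    intervalIntegral.integral_add (Continuous.intervalIntegrable (by fun_prop) _ _)
      (Continuous.intervalIntegrable (by fun_prop) _ _),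
    intervalIntegral.integral_const_mul, intervalIntegral.integral_const_mul,
    intervalIntegral.integral_const_mul, ← hL_def, ← hS_def] at key
  have h5 : 1 / (2 * δ) * (∫ u in (0 : ℝ)..v, Real.exp (-(2 * α) * u)) ≤
      1 / (2 * δ) * (1 / (2 * α)) := by gcongr
  have h6 : 1 / (2 * δ) * (1 / (2 * α)) = z / 4 := by
    rw [hδ_def, hα_def]
    field_simp
    norm_num
  have h7 : δ / 2 * S = z / 4 := by
    rw [hδ_def]
    field_simp
    norm_num
  have h8 : z / 2 ≤ α * L := by linarith
  have h9 : z ^ 3 ≤ 4 * S * L := by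
    rw [hα_def, div_mul_eq_mul_div, le_div_iff₀ (by positivity)] at h8
    linarith
  have : pathK σ b v a = σ * L := rfl
  rw [this]
  nlinarith

/-- Complete the square, `c|a| - a²/2 ≤ c²/2`; the normalising constant is below `1`. -/
lemma gaussianPDFReal_mul_exp_le (c a : ℝ) :
    gaussianPDFReal 0 1 a * Real.exp (c * |a|) ≤ Real.exp (c ^ 2 / 2) := by
  have h1 : (√(2 * Real.pi * (1 : ℝ≥0)))⁻¹ ≤ 1 := by
    refine inv_le_one_of_one_le₀ (Real.one_le_sqrt.2 ?_)
    have := Real.pi_gt_three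
    push_cast
    linarith
  have h2 : Real.exp (-(a - 0) ^ 2 / (2 * (1 : ℝ≥0))) * Real.exp (c * |a|) ≤
      Real.exp (c ^ 2 / 2) := by
    rw [← Real.exp_add]
    refine Real.exp_le_exp.2 ?_
    push_cast
    nlinarith [sq_nonneg (|a| - c), sq_abs a]
  rw [gaussianPDFReal, mul_assoc]
  calc _ ≤ 1 * Real.exp (c ^ 2 / 2) := by gcongr
    _ = _ := one_mul _

lemma integral_pathIntegrand_sq_le (hσ : 0 < σ) (hv : 0 < v) (hv₁ : v ≤ 1) (hb : Continuous b)
    (a : ℝ) :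
    ∫ u in (0 : ℝ)..v, pathIntegrand σ b a u ^ 2 ≤
      Real.exp (2 * σ * |a|) * ∫ u in (0 : ℝ)..v, Real.exp (2 * σ * b u) := by
  have hc := continuous_pathIntegrand (σ := σ) hb a
  rw [← intervalIntegral.integral_const_mul]
  refine intervalIntegral.integral_mono_on hv.le
    (Continuous.intervalIntegrable (by fun_prop) _ _)
    (Continuous.intervalIntegrable (by fun_prop) _ _) fun u hu ↦ ?_
  unfold pathIntegrand
  rw [← Real.exp_nat_mul, ← Real.exp_add]
  refine Real.exp_le_exp.2 ?_
  have h1 : u * a ≤ |a| := by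
    calc u * a ≤ |u * a| := le_abs_self _
      _ = |u| * |a| := abs_mul _ _
      _ ≤ 1 * |a| := by
        gcongr
        rw [abs_of_nonneg hu.1]
        exact hu.2.trans hv₁
      _ = |a| := one_mul _
  have h2 : σ * (u * a) ≤ σ * |a| := by gcongr
  have h3 : 0 ≤ σ ^ 2 * u := mul_nonneg (sq_nonneg _) hu.1
  push_cast
  nlinarith

/-- The right side no longer contains the random solution `a(v, z)`, so it can serve as an
integrable majorant. -/
lemma gaussianPDFReal_div_pathK_le (hσ : 0 < σ) (hv : 0 < v) (hv₁ : v ≤ 1) (hb : Continuous b)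
    {z : ℝ} (hz : 0 < z) :
    gaussianPDFReal 0 1 (pathA σ b v z) / pathK σ b v (pathA σ b v z) ≤
      4 * Real.exp ((2 * σ) ^ 2 / 2) / (z ^ 3 * σ) *
        ∫ u in (0 : ℝ)..v, Real.exp (2 * σ * b u) := by
  set a := pathA σ b v z
  have hK := pathK_pos hσ hv hb a
  have h1 := pow_three_le_mul_pathK hσ hv hb a
  rw [pathF_pathA hσ hv hb hz] at h1
  have h2 := integral_pathIntegrand_sq_le hσ hv hv₁ hb a
  have h3 := gaussianPDFReal_mul_exp_le (2 * σ) a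
  set I := ∫ u in (0 : ℝ)..v, Real.exp (2 * σ * b u)
  have hI : 0 ≤ I := intervalIntegral.integral_nonneg hv.le fun _ _ ↦ (Real.exp_pos _).le
  have hφ := gaussianPDFReal_nonneg 0 1 a
  rw [div_le_iff₀ hK, div_mul_eq_mul_div, div_mul_eq_mul_div, le_div_iff₀ (by positivity)]
  calc gaussianPDFReal 0 1 a * (z ^ 3 * σ)
      ≤ gaussianPDFReal 0 1 a * (4 * (Real.exp (2 * σ * |a|) * I) * pathK σ b v a) := by
        refine mul_le_mul_of_nonneg_left (h1.trans ?_) hφ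
        gcongr
    _ = 4 * (gaussianPDFReal 0 1 a * Real.exp (2 * σ * |a|)) * I * pathK σ b v a := by ring
    _ ≤ _ := by gcongr

end

section

/-! ### Exponential functionals of a process with continuous paths -/

lemma lintegral_prodMk_of_indepFun {Ω Ω₁ Ω₂ : Type*} {mΩ : MeasurableSpace Ω}
    {m₁ : MeasurableSpace Ω₁} {m₂ : MeasurableSpace Ω₂} {P : Measure Ω} [IsProbabilityMeasure P]
    {X : Ω → Ω₁} {Y : Ω → Ω₂} (hX : Measurable X) (hY : Measurable Y) (h : IndepFun X Y P)
    {H : Ω₁ × Ω₂ → ℝ≥0∞} (hH : Measurable H) :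
    ∫⁻ ω, H (X ω, Y ω) ∂P = ∫⁻ a, ∫⁻ ω, H (a, Y ω) ∂P ∂(P.map X) := by
  have := Measure.isProbabilityMeasure_map (μ := P) hX.aemeasurable
  have := Measure.isProbabilityMeasure_map (μ := P) hY.aemeasurable
  rw [← lintegral_map hH (hX.prodMk hY),
    (indepFun_iff_map_prod_eq_prod_map_map hX.aemeasurable hY.aemeasurable).1 h,
    lintegral_prod _ hH.aemeasurable]
  exact lintegral_congr fun a ↦ lintegral_map (hH.comp measurable_prodMk_left) hY

variable {Ω : Type*} {σ v : ℝ} {Z : ℝ → Ω → ℝ}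

/-! ### Joint measurability in the parameter and the sample point -/

lemma measurable_uncurry_path {m : MeasurableSpace Ω} (hZc : ∀ ω, Continuous (Z · ω))
    (hZ : ∀ u, Measurable (Z u)) : Measurable (fun p : Ω × ℝ ↦ Z p.2 p.1) :=
  (measurable_uncurry_of_continuous_of_measurable hZc hZ).comp measurable_swap

lemma measurable_uncurry_pathIntegrand {m : MeasurableSpace Ω} (hZc : ∀ ω, Continuous (Z · ω))
    (hZ : ∀ u, Measurable (Z u)) (σ : ℝ) :
    Measurable (fun p : (ℝ × Ω) × ℝ ↦ pathIntegrand σ (Z · p.1.2) p.1.1 p.2) := by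
  have h : Measurable (fun p : (ℝ × Ω) × ℝ ↦ Z p.2 p.1.2) :=
    (measurable_uncurry_path hZc hZ).comp (by fun_prop : Measurable fun p : (ℝ × Ω) × ℝ ↦
      (p.1.2, p.2))
  exact Real.measurable_exp.comp (((h.add (by fun_prop)).const_mul σ).sub (by fun_prop))

lemma measurable_uncurry_pathF {m : MeasurableSpace Ω} (hZc : ∀ ω, Continuous (Z · ω))
    (hZ : ∀ u, Measurable (Z u)) (hv : 0 < v) :
    Measurable (fun p : ℝ × Ω ↦ pathF σ (Z · p.2) v p.1) := by
  simp_rw [pathF, intervalIntegral.integral_of_le hv.le]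
  exact ((measurable_uncurry_pathIntegrand hZc hZ σ).stronglyMeasurable.integral_prod_right'
    (ν := volume.restrict (Set.Ioc 0 v))).measurable

lemma measurable_uncurry_pathK {m : MeasurableSpace Ω} (hZc : ∀ ω, Continuous (Z · ω))
    (hZ : ∀ u, Measurable (Z u)) (hv : 0 < v) :
    Measurable (fun p : ℝ × Ω ↦ pathK σ (Z · p.2) v p.1) := by
  simp_rw [pathK, intervalIntegral.integral_of_le hv.le]
  exact (((measurable_snd.mul
    (measurable_uncurry_pathIntegrand hZc hZ σ)).stronglyMeasurable.integral_prod_right'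
    (ν := volume.restrict (Set.Ioc 0 v))).measurable).const_mul σ

lemma measurable_uncurry_pathA {m : MeasurableSpace Ω} (hZc : ∀ ω, Continuous (Z · ω))
    (hZ : ∀ u, Measurable (Z u)) (hσ : 0 < σ) (hv : 0 < v) :
    Measurable (fun p : ℝ × Ω ↦ pathA σ (Z · p.2) v p.1) := by
  refine measurable_of_Iic fun c ↦ ?_
  -- For `z ≤ 0` there is no solution, and `Function.invFun` returns one fixed default real, the
  -- same for every path.
  have h : (fun p : ℝ × Ω ↦ pathA σ (Z · p.2) v p.1) ⁻¹' Set.Iic c =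
      {p | 0 < p.1 ∧ p.1 ≤ pathF σ (Z · p.2) v c} ∪
        {p | p.1 ≤ 0 ∧ Classical.choice (inferInstance : Nonempty ℝ) ≤ c} := by
    ext p
    rcases lt_or_ge 0 p.1 with hp | hp
    · simp [hp, hp.not_ge, pathA_le_iff hσ hv (hZc p.2) hp]
    · have h0 : pathA σ (Z · p.2) v p.1 = Classical.choice (inferInstance : Nonempty ℝ) :=
        Function.invFun_neg fun ⟨a, ha⟩ ↦ ((pathF_pos hv (hZc p.2) a).trans_le (ha.trans_le hp)).false
      simp [hp, hp.not_gt, h0]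
  rw [h]
  have hF : Measurable fun p : ℝ × Ω ↦ pathF σ (Z · p.2) v c :=
    (measurable_uncurry_pathF hZc hZ hv).comp (by fun_prop : Measurable fun p : ℝ × Ω ↦ (c, p.2))
  exact ((measurableSet_lt measurable_const measurable_fst).inter
    (measurableSet_le measurable_fst hF)).union
    ((measurableSet_le measurable_fst measurable_const).inter (MeasurableSet.const _))

/-- The random variable `φ (a(v, z)) / K(v, a(v, z))` along a path `b`. -/
noncomputable def pathDensity (σ : ℝ) (b : ℝ → ℝ) (v z : ℝ) : ℝ :=
  gaussianPDFReal 0 1 (pathA σ b v z) / pathK σ b v (pathA σ b v z)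

lemma pathDensity_nonneg (hσ : 0 < σ) (hv : 0 < v) {b : ℝ → ℝ} (hb : Continuous b) (z : ℝ) :
    0 ≤ pathDensity σ b v z :=
  div_nonneg (gaussianPDFReal_nonneg _ _ _) (pathK_pos hσ hv hb _).le

lemma measurable_uncurry_pathDensity {m : MeasurableSpace Ω} (hZc : ∀ ω, Continuous (Z · ω))
    (hZ : ∀ u, Measurable (Z u)) (hσ : 0 < σ) (hv : 0 < v) :
    Measurable (fun p : ℝ × Ω ↦ pathDensity σ (Z · p.2) v p.1) := by
  have hA := measurable_uncurry_pathA hZc hZ hσ hv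
  have hK : Measurable (fun p : ℝ × Ω ↦ pathK σ (Z · p.2) v (pathA σ (Z · p.2) v p.1)) :=
    Measurable.comp (g := fun p : ℝ × Ω ↦ pathK σ (Z · p.2) v p.1)
      (f := fun p : ℝ × Ω ↦ (pathA σ (Z · p.2) v p.1, p.2))
      (measurable_uncurry_pathK hZc hZ hv) (hA.prodMk measurable_snd)
  have hφ : Measurable (fun p : ℝ × Ω ↦ gaussianPDFReal 0 1 (pathA σ (Z · p.2) v p.1)) :=
    (measurable_gaussianPDFReal 0 1).comp hA
  simp only [pathDensity]
  exact hφ.div hK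

/-! ### Conditional law and density under independence -/

section Law

variable {mΩ : MeasurableSpace Ω} {P : Measure Ω} {X : Ω → ℝ}

lemma integrable_pathDensity (hZc : ∀ ω, Continuous (Z · ω)) (hZ : ∀ u, Measurable (Z u))
    (hσ : 0 < σ) (hv : 0 < v) (hv₁ : v ≤ 1)
    (hM : Integrable (fun ω ↦ ∫ u in (0 : ℝ)..v, Real.exp (2 * σ * Z u ω)) P)
    {z : ℝ} (hz : 0 < z) : Integrable (fun ω ↦ pathDensity σ (Z · ω) v z) P := by
  refine Integrable.mono' (hM.const_mul (4 * Real.exp ((2 * σ) ^ 2 / 2) / (z ^ 3 * σ)))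
    ((measurable_uncurry_pathDensity hZc hZ hσ hv).comp
      measurable_prodMk_left).aestronglyMeasurable (ae_of_all _ fun ω ↦ ?_)
  rw [Real.norm_of_nonneg (pathDensity_nonneg hσ hv (hZc ω) z)]
  exact gaussianPDFReal_div_pathK_le hσ hv hv₁ (hZc ω) hz

variable [IsProbabilityMeasure P]

lemma lintegral_pathF_of_indep (hX : Measurable X) (hZc : ∀ ω, Continuous (Z · ω))
    (hZ : ∀ u, Measurable (Z u)) (hXZ : IndepFun X (fun ω u ↦ Z u ω) P) (hv : 0 < v)
    {g : ℝ × ℝ → ℝ≥0∞} (hg : Measurable g) :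
    ∫⁻ ω, g (X ω, pathF σ (Z · ω) v (X ω)) ∂P =
      ∫⁻ a, ∫⁻ ω, g (a, pathF σ (Z · ω) v a) ∂P ∂(P.map X) := by
  -- Continuity of the paths is what makes `pathF` jointly measurable, so `Z` is viewed in the
  -- subtype of continuous paths. The subtype carries the induced σ-algebra, hence `Y` generates the
  -- same σ-algebra as `Z` and independence survives.
  let Y : Ω → {b : ℝ → ℝ // Continuous b} := fun ω ↦ ⟨(Z · ω), hZc ω⟩
  have hY : Measurable Y := (measurable_pi_lambda _ hZ).subtype_mk
  have hXY : IndepFun X Y P := by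
    rw [IndepFun_iff_Indep] at hXZ ⊢
    change Indep _ (MeasurableSpace.comap Y (MeasurableSpace.comap Subtype.val _)) P
    rw [MeasurableSpace.comap_comp]
    exact hXZ
  have hF := measurable_uncurry_pathF (σ := σ)
    (Z := fun u (b : {b : ℝ → ℝ // Continuous b}) ↦ b.1 u) (fun b ↦ b.2)
    (fun u ↦ (measurable_pi_apply u).comp measurable_subtype_coe) hv
  exact lintegral_prodMk_of_indepFun hX hY hXY
    (H := fun p ↦ g (p.1, pathF σ p.2.1 v p.1)) (hg.comp (measurable_fst.prodMk hF))

/-- The laws of `F(v, a)` form a Markov kernel `κ` in `a`; by independence the joint law is `P.map X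
⊗ₘ κ`, and disintegration is almost everywhere unique. -/
lemma condDistrib_pathF_ae_eq (hX : Measurable X) (hZc : ∀ ω, Continuous (Z · ω))
    (hZ : ∀ u, Measurable (Z u)) (hXZ : IndepFun X (fun ω u ↦ Z u ω) P) (hv : 0 < v) :
    ∀ᵐ a ∂(P.map X), condDistrib (fun ω ↦ pathF σ (Z · ω) v (X ω)) X P a =
      P.map (fun ω ↦ pathF σ (Z · ω) v a) := by
  have hF := measurable_uncurry_pathF (σ := σ) hZc hZ hv
  have hFa (a : ℝ) : Measurable (fun ω ↦ pathF σ (Z · ω) v a) := hF.comp measurable_prodMk_left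
  have hη : Measurable (fun ω ↦ pathF σ (Z · ω) v (X ω)) := hF.comp (hX.prodMk measurable_id)
  let κ : Kernel ℝ ℝ := (Kernel.id ×ₖ Kernel.const ℝ P).map (fun p ↦ pathF σ (Z · p.2) v p.1)
  have hκ (a : ℝ) : κ a = P.map (fun ω ↦ pathF σ (Z · ω) v a) := by
    rw [Kernel.map_apply _ hF, Kernel.prod_apply, Kernel.id_apply, Kernel.const_apply,
      Measure.dirac_prod, Measure.map_map hF measurable_prodMk_left]
    rfl
  have hκ_markov : IsMarkovKernel κ := Kernel.IsMarkovKernel.map _ hF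
  have := Measure.isProbabilityMeasure_map (μ := P) hX.aemeasurable
  have h := condDistrib_ae_eq_of_measure_eq_compProd (μ := P) (κ := κ) X hη.aemeasurable ?_
  · filter_upwards [h] with a ha using by rw [ha, hκ]
  · ext s hs
    have h := lintegral_pathF_of_indep (σ := σ) hX hZc hZ hXZ hv
      (measurable_one.indicator hs : Measurable (s.indicator (1 : ℝ × ℝ → ℝ≥0∞)))
    rw [Measure.compProd_apply hs, ← lintegral_indicator_one hs,
      lintegral_map (measurable_one.indicator hs) (hX.prodMk hη), h]
    refine lintegral_congr fun a ↦ ?_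
    rw [hκ, ← lintegral_indicator_one (measurable_prodMk_left hs),
      lintegral_map (measurable_one.indicator (measurable_prodMk_left hs)) (hFa a)]
    rfl

/-- Tonelli, the change of variables for each fixed path, and Tonelli again. Integrability enters
only to replace the lower integral over `ω` by a real expectation. -/
lemma map_pathF_eq_withDensity (hX : HasLaw X (gaussianReal 0 1) P) (hXm : Measurable X)
    (hZc : ∀ ω, Continuous (Z · ω))
    (hZ : ∀ u, Measurable (Z u)) (hXZ : IndepFun X (fun ω u ↦ Z u ω) P) (hσ : 0 < σ) (hv : 0 < v)
    (hI : ∀ z, 0 < z → Integrable (fun ω ↦ pathDensity σ (Z · ω) v z) P) :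
    P.map (fun ω ↦ pathF σ (Z · ω) v (X ω)) = volume.withDensity
      ((Set.Ioi (0 : ℝ)).indicator
        fun z ↦ ENNReal.ofReal (∫ ω, pathDensity σ (Z · ω) v z ∂P)) := by
  have hF := measurable_uncurry_pathF (σ := σ) hZc hZ hv
  have hη : Measurable (fun ω ↦ pathF σ (Z · ω) v (X ω)) := hF.comp (hXm.prodMk measurable_id)
  have hD : Measurable fun p : ℝ × Ω ↦ ENNReal.ofReal (pathDensity σ (Z · p.2) v p.1) :=
    (measurable_uncurry_pathDensity hZc hZ hσ hv).ennreal_ofReal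
  have hD' : Measurable fun p : Ω × ℝ ↦ ENNReal.ofReal (pathDensity σ (Z · p.1) v p.2) :=
    Measurable.comp (g := fun p : ℝ × Ω ↦ ENNReal.ofReal (pathDensity σ (Z · p.2) v p.1))
      (f := Prod.swap) hD measurable_swap
  have hDz (z : ℝ) : Measurable fun ω ↦ ENNReal.ofReal (pathDensity σ (Z · ω) v z) :=
    Measurable.comp (g := fun p : ℝ × Ω ↦ ENNReal.ofReal (pathDensity σ (Z · p.2) v p.1))
      (f := fun ω ↦ (z, ω)) hD measurable_prodMk_left
  ext s hs
  have hs1 : Measurable (s.indicator (1 : ℝ → ℝ≥0∞)) := measurable_one.indicator hs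
  rw [withDensity_apply _ hs, ← lintegral_indicator_one hs, lintegral_map hs1 hη,
    lintegral_pathF_of_indep hXm hZc hZ hXZ hv (g := fun p ↦ s.indicator 1 p.2)
      (hs1.comp measurable_snd), hX.map_eq, gaussianReal_of_var_ne_zero _ one_ne_zero,
    lintegral_withDensity_eq_lintegral_mul _ (measurable_gaussianPDF 0 1)]
  rotate_left
  · exact ((hs1.comp hF).comp measurable_swap).lintegral_prod_left'
  simp_rw [Pi.mul_apply]
  calc ∫⁻ a, gaussianPDF 0 1 a * ∫⁻ ω, s.indicator 1 (pathF σ (Z · ω) v a) ∂P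
      = ∫⁻ a, ∫⁻ ω, gaussianPDF 0 1 a * s.indicator 1 (pathF σ (Z · ω) v a) ∂P :=
        lintegral_congr fun a ↦
          (lintegral_const_mul _ (hs1.comp (hF.comp measurable_prodMk_left))).symm
    _ = ∫⁻ ω, (∫⁻ a, gaussianPDF 0 1 a * s.indicator 1 (pathF σ (Z · ω) v a)) ∂P := by
        refine lintegral_lintegral_swap ?_
        exact (((measurable_gaussianPDF 0 1).comp measurable_fst).mul
          (hs1.comp hF)).aemeasurable
    _ = ∫⁻ ω, (∫⁻ z in Set.Ioi (0 : ℝ),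
          ENNReal.ofReal (pathDensity σ (Z · ω) v z) * s.indicator 1 z) ∂P :=
        lintegral_congr fun ω ↦ setLIntegral_pathF hσ hv (hZc ω) (gaussianPDFReal 0 1) (s.indicator 1)
    _ = ∫⁻ z in Set.Ioi (0 : ℝ), ∫⁻ ω,
          ENNReal.ofReal (pathDensity σ (Z · ω) v z) * s.indicator 1 z ∂P := by
        refine lintegral_lintegral_swap ?_
        exact (hD'.mul (hs1.comp measurable_snd)).aemeasurable
    _ = ∫⁻ z in Set.Ioi (0 : ℝ),
          ENNReal.ofReal (∫ ω, pathDensity σ (Z · ω) v z ∂P) * s.indicator 1 z := by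
        refine setLIntegral_congr_fun measurableSet_Ioi fun z hz ↦ ?_
        rw [lintegral_mul_const _ (hDz z), ofReal_integral_eq_lintegral_ofReal (hI z hz)
            (ae_of_all _ fun ω ↦ pathDensity_nonneg hσ hv (hZc ω) z)]
    _ = _ := by
        rw [← lintegral_indicator measurableSet_Ioi, ← lintegral_indicator hs]
        refine lintegral_congr fun z ↦ ?_
        by_cases h1 : z ∈ s <;> by_cases h2 : z ∈ Set.Ioi (0 : ℝ) <;> simp [h1, h2]

end Law

end

section

/-! ### The Brownian bridge -/

variable {Ω : Type*}

/-- The path `u ↦ W_u - u W_1` of the bridge from `0` to `0`, stopped at time `1`. -/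
def bridgePath (W : ℝ≥0 → Ω → ℝ) (u : ℝ) (ω : Ω) : ℝ :=
  W (min u.toNNReal 1) ω - (min u.toNNReal 1 : ℝ≥0) * W 1 ω

lemma bridge_toNNReal (W : ℝ≥0 → Ω → ℝ) (a : ℝ) {u : ℝ} (hu₀ : 0 ≤ u) (hu₁ : u ≤ 1) (ω : Ω) :
    bridge W a u.toNNReal ω = bridgePath W u ω + u * a := by
  rw [bridge, bridgePath, min_eq_left (Real.toNNReal_le_one.2 hu₁), Real.coe_toNNReal u hu₀]

/-! ### Identification with the fixed-path functionals -/

section Pathwise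

variable {σ v : ℝ} (W : ℝ≥0 → Ω → ℝ) (ω : Ω)

lemma bridgeF_eq_pathF (hv₀ : 0 ≤ v) (hv₁ : v ≤ 1) (a : ℝ) :
    bridgeF σ W v a ω = pathF σ (bridgePath W · ω) v a := by
  refine intervalIntegral.integral_congr fun u hu ↦ ?_
  rw [Set.uIcc_of_le hv₀] at hu
  simp only [pathIntegrand]
  rw [bridge_toNNReal W a hu.1 (hu.2.trans hv₁)]

lemma bridgeK_eq_pathK (hv₀ : 0 ≤ v) (hv₁ : v ≤ 1) (a : ℝ) :
    bridgeK σ W v a ω = pathK σ (bridgePath W · ω) v a := by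
  refine congrArg (σ * ·) (intervalIntegral.integral_congr fun u hu ↦ ?_)
  rw [Set.uIcc_of_le hv₀] at hu
  simp only [pathIntegrand]
  rw [bridge_toNNReal W a hu.1 (hu.2.trans hv₁)]

lemma expFunctional_eq_pathF (hv₀ : 0 ≤ v) (hv₁ : v ≤ 1) :
    expFunctional σ W v ω = pathF σ (bridgePath W · ω) v (W 1 ω) := by
  rw [← bridgeF_eq_pathF W ω hv₀ hv₁]
  refine intervalIntegral.integral_congr fun u _ ↦ ?_
  simp only [bridge, sub_add_cancel]

lemma implicitA_eq_pathA (hv₀ : 0 ≤ v) (hv₁ : v ≤ 1) (z : ℝ) :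
    implicitA σ W v z ω = pathA σ (bridgePath W · ω) v z :=
  congrArg (Function.invFun · z) (funext (bridgeF_eq_pathF W ω hv₀ hv₁))

lemma densityIntegrand_eq_pathDensity (hv₀ : 0 ≤ v) (hv₁ : v ≤ 1) (z : ℝ) :
    densityIntegrand σ W v z ω = pathDensity σ (bridgePath W · ω) v z := by
  rw [densityIntegrand, pathDensity, implicitA_eq_pathA W ω hv₀ hv₁,
    bridgeK_eq_pathK W ω hv₀ hv₁]

lemma continuous_bridgePath {W : ℝ≥0 → Ω → ℝ} {ω : Ω} (h : Continuous (W · ω)) :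
    Continuous (bridgePath W · ω) := by
  have h1 : Continuous fun u : ℝ ↦ min u.toNNReal 1 := continuous_real_toNNReal.min continuous_const
  exact (h.comp h1).sub ((NNReal.continuous_coe.comp h1).mul continuous_const)

end Pathwise

/-! ### Regular version, exponential moments and independence -/

variable {mΩ : MeasurableSpace Ω} {P : Measure Ω} {W : ℝ≥0 → Ω → ℝ}

lemma measurable_bridgePath (h : ∀ t, Measurable (W t)) (u : ℝ) : Measurable (bridgePath W u) :=
  (h _).sub ((h 1).const_mul _)

/-- A process which is measurable up to null sets and has almost surely continuous paths is
indistinguishable from a measurable process all of whose paths are continuous. -/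
lemma exists_measurable_continuous_modification (hm : ∀ t, AEMeasurable (W t) P)
    (hc : ∀ᵐ ω ∂P, Continuous (W · ω)) :
    ∃ W' : ℝ≥0 → Ω → ℝ, (∀ t, Measurable (W' t)) ∧ (∀ ω, Continuous (W' · ω)) ∧
      ∀ᵐ ω ∂P, ∀ t, W t ω = W' t ω := by
  classical
  -- Only countably many null sets can be discarded at once; continuity then recovers measurability
  -- at every time as a limit along `D`.
  obtain ⟨D, hDc, hDd⟩ := TopologicalSpace.exists_countable_dense ℝ≥0
  have hgood : ∀ᵐ ω ∂P, Continuous (W · ω) ∧ ∀ t ∈ D, W t ω = (hm t).mk (W t) ω :=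
    hc.and ((ae_ball_iff hDc).2 fun t _ ↦ (hm t).ae_eq_mk)
  obtain ⟨N, hN, hNm, hN0⟩ := exists_measurable_superset_of_null (ae_iff.1 hgood)
  have hNgood (ω : Ω) (hω : ω ∈ Nᶜ) :
      Continuous (W · ω) ∧ ∀ t ∈ D, W t ω = (hm t).mk (W t) ω := by
    by_contra h
    exact hω (hN h)
  refine ⟨fun t ↦ Nᶜ.indicator (W t), fun t ↦ ?_, fun ω ↦ ?_, ?_⟩
  · obtain ⟨q, hqD, hq⟩ := mem_closure_iff_seq_limit.1 (hDd t)
    refine measurable_of_tendsto_metrizable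
      (f := fun n ↦ Nᶜ.indicator ((hm (q n)).mk (W (q n))))
      (fun n ↦ (hm (q n)).measurable_mk.indicator hNm.compl) (tendsto_pi_nhds.2 fun ω ↦ ?_)
    by_cases hω : ω ∈ Nᶜ
    · simp only [Set.indicator_of_mem hω, ← (hNgood ω hω).2 _ (hqD _)]
      exact ((hNgood ω hω).1.tendsto t).comp hq
    · simp only [Set.indicator_of_notMem hω]
      exact tendsto_const_nhds
  · by_cases hω : ω ∈ Nᶜ
    · simpa only [Set.indicator_of_mem hω] using (hNgood ω hω).1
    · simpa only [Set.indicator_of_notMem hω] using continuous_const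
  · filter_upwards [measure_eq_zero_iff_ae_notMem.1 hN0] with ω hω t
    exact (Set.indicator_of_mem (s := Nᶜ) hω (W t)).symm

lemma HasLaw.integral_exp_mul {X : Ω → ℝ} {τ : ℝ≥0} (hX : HasLaw X (gaussianReal 0 τ) P) (c : ℝ) :
    Integrable (fun ω ↦ Real.exp (c * X ω)) P ∧
      ∫ ω, Real.exp (c * X ω) ∂P = Real.exp (τ * c ^ 2 / 2) := by
  have h := mgf_gaussianReal hX.map_eq c
  rw [zero_mul, zero_add] at h
  -- A positive moment generating function forces integrability, because the integral of a
  -- non-integrable function is `0` by convention; that criterion needs `P ≠ 0`.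
  have : NeZero P := ⟨fun h0 ↦ by simp [h0, mgf] at h; exact (Real.exp_pos _).ne h⟩
  exact ⟨mgf_pos_iff.1 (h ▸ Real.exp_pos _), h⟩

lemma integrable_integral_exp_bridgePath [IsProbabilityMeasure P] (hW : IsPreBrownianReal W P)
    (hm : ∀ t, Measurable (W t)) (hc : ∀ ω, Continuous (W · ω)) (c : ℝ) {v : ℝ} (hv : 0 ≤ v) :
    Integrable (fun ω ↦ ∫ u in (0 : ℝ)..v, Real.exp (c * bridgePath W u ω)) P := by
  simp_rw [intervalIntegral.integral_of_le hv]
  have hmeas : StronglyMeasurable fun p : Ω × ℝ ↦ Real.exp (c * bridgePath W p.2 p.1) :=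
    (Real.measurable_exp.comp ((measurable_uncurry_path
      (fun ω ↦ continuous_bridgePath (hc ω)) (measurable_bridgePath hm)).const_mul
        c)).stronglyMeasurable
  -- The bound `x y ≤ x² + y²` reduces the bridge to one-dimensional Gaussian marginals.
  have hle (u : ℝ) (ω : Ω) : Real.exp (c * bridgePath W u ω) ≤
      Real.exp (2 * c * W (min u.toNNReal 1) ω) +
        Real.exp (-2 * c * (min u.toNNReal 1 : ℝ≥0) * W 1 ω) := by
    set x := Real.exp (c * W (min u.toNNReal 1) ω)
    set y := Real.exp (-c * (min u.toNNReal 1 : ℝ≥0) * W 1 ω)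
    have h1 : Real.exp (c * bridgePath W u ω) = x * y := by
      rw [← Real.exp_add, bridgePath]
      ring_nf
    have h2 : Real.exp (2 * c * W (min u.toNNReal 1) ω) = x ^ 2 := by
      rw [← Real.exp_nat_mul]
      push_cast
      ring_nf
    have h3 : Real.exp (-2 * c * (min u.toNNReal 1 : ℝ≥0) * W 1 ω) = y ^ 2 := by
      rw [← Real.exp_nat_mul]
      push_cast
      ring_nf
    rw [h1, h2, h3]
    nlinarith [sq_nonneg (x - y), sq_nonneg x, sq_nonneg y]
  have hlaw (u : ℝ) := HasLaw.integral_exp_mul (hW.hasLaw_eval (min u.toNNReal 1)) (2 * c)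
  have hlaw₁ (u : ℝ) := HasLaw.integral_exp_mul (hW.hasLaw_eval 1)
    (-2 * c * (min u.toNNReal 1 : ℝ≥0))
  have hint (u : ℝ) : Integrable (fun ω ↦ Real.exp (c * bridgePath W u ω)) P :=
    ((hlaw u).1.add (hlaw₁ u).1).mono'
      (hmeas.comp_measurable (by fun_prop : Measurable fun ω : Ω ↦ (ω, u))).aestronglyMeasurable
      (ae_of_all _ fun ω ↦ (Real.norm_of_nonneg (Real.exp_pos _).le).trans_le (hle u ω))
  refine Integrable.integral_prod_left (μ := P) (ν := volume.restrict (Set.Ioc 0 v))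
    (f := fun p : Ω × ℝ ↦ Real.exp (c * bridgePath W p.2 p.1)) ?_
  refine (integrable_prod_iff' hmeas.aestronglyMeasurable).2 ⟨ae_of_all _ hint, ?_⟩
  refine Integrable.of_bound hmeas.norm.integral_prod_left'.aestronglyMeasurable
    -- The two moments are `exp (2 c² τ)` and `exp (2 c² τ²)` with `0 ≤ τ ≤ 1`.
    (2 * Real.exp (2 * c ^ 2)) (ae_of_all _ fun u ↦ ?_)
  rw [Real.norm_of_nonneg (integral_nonneg fun _ ↦ norm_nonneg _)]
  have hτ : ((min u.toNNReal 1 : ℝ≥0) : ℝ) ≤ 1 := by exact_mod_cast min_le_right _ _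
  have hτ₀ : 0 ≤ ((min u.toNNReal 1 : ℝ≥0) : ℝ) := NNReal.coe_nonneg _
  calc ∫ ω, ‖Real.exp (c * bridgePath W u ω)‖ ∂P
      ≤ ∫ ω, (Real.exp (2 * c * W (min u.toNNReal 1) ω) +
        Real.exp (-2 * c * (min u.toNNReal 1 : ℝ≥0) * W 1 ω)) ∂P :=
        integral_mono (hint u).norm ((hlaw u).1.add (hlaw₁ u).1)
          fun ω ↦ (Real.norm_of_nonneg (Real.exp_pos _).le).trans_le (hle u ω)
    _ ≤ _ := by
        rw [integral_add (hlaw u).1 (hlaw₁ u).1, (hlaw u).2, (hlaw₁ u).2]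
        set τ := ((min u.toNNReal 1 : ℝ≥0) : ℝ)
        have hc2 := sq_nonneg c
        have hττ : τ ^ 2 ≤ 1 := pow_le_one₀ hτ₀ hτ
        rw [two_mul (Real.exp _)]
        refine add_le_add (Real.exp_le_exp.2 ?_) (Real.exp_le_exp.2 ?_)
        · nlinarith
        · rw [NNReal.coe_one]
          nlinarith

/-- With `τ = min u 1`, the covariance of `W_1` and `W_τ - τ W_1` is `τ - τ = 0`, and for jointly
Gaussian processes this means independence. -/
lemma indepFun_eval_one_bridgePath [IsProbabilityMeasure P] (hW : IsPreBrownianReal W P)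
    (hm : ∀ t, Measurable (W t)) : IndepFun (W 1) (fun ω u ↦ bridgePath W u ω) P := by
  classical
  have hG : IsGaussianProcess
      (Sum.elim (fun _ : Unit ↦ W 1) (fun u : ℝ ↦ bridgePath W u)) P := by
    refine hW.isGaussianProcess.of_isGaussianProcess ?_
    rintro (_ | u)
    · exact ⟨{1}, .proj ⟨1, by simp⟩, fun ω ↦ rfl⟩
    · exact ⟨{min u.toNNReal 1, 1}, .proj ⟨min u.toNNReal 1, by simp⟩ -
        ((min u.toNNReal 1 : ℝ≥0) : ℝ) • .proj ⟨1, by simp⟩, fun ω ↦ rfl⟩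
  have h := hG.indepFun_of_covariance_eq_zero (fun _ ↦ (hm 1).aemeasurable)
    (fun u ↦ (measurable_bridgePath hm u).aemeasurable) fun _ u ↦ ?_
  · exact h.comp (φ := fun x : Unit → ℝ ↦ x ()) (ψ := id) (measurable_pi_apply ()) measurable_id
  · have hL (t : ℝ≥0) := (hW.isGaussianProcess.hasGaussianLaw_eval t).memLp_two
    change cov[W 1, fun ω ↦ W (min u.toNNReal 1) ω - (min u.toNNReal 1 : ℝ≥0) * W 1 ω; P] = 0
    rw [covariance_fun_sub_right (hL _) (hL _) ((hL 1).const_mul _), covariance_const_mul_right,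
      hW.covariance_fun_eval, hW.covariance_fun_eval]
    simp

end

end

end AsianOption

/-! ### Transfer to the original process -/

theorem mainTheorem3 {Ω : Type*} [MeasurableSpace Ω] (P : Measure Ω) [IsProbabilityMeasure P]
    (W : ℝ≥0 → Ω → ℝ) (hW : IsBrownianReal W P)
    (σ : ℝ) (hσ : 0 < σ) (v : ℝ) (hv₀ : 0 < v) (hv₁ : v ≤ 1) :
    -- the law of the functional has a density with respect to Lebesgue measure
    HasPDF (AsianOption.expFunctional σ W v) P volume ∧
    -- conditionally on `W_1 = a`, the functional has the law of `F(v, a)`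
    (∀ᵐ a ∂(P.map (W 1)),
      condDistrib (AsianOption.expFunctional σ W v) (W 1) P a =
        P.map (AsianOption.bridgeF σ W v a)) ∧
    -- almost surely, `K = ∂F/∂a > 0`
    (∀ᵐ ω ∂P, ∀ a : ℝ,
      HasDerivAt (fun x : ℝ => AsianOption.bridgeF σ W v x ω) (AsianOption.bridgeK σ W v a ω) a ∧
      0 < AsianOption.bridgeK σ W v a ω) ∧
    -- almost surely, for all `z > 0`, `a(v, z)` is the unique solution of `F(v, a) = z`
    (∀ᵐ ω ∂P, ∀ z : ℝ, 0 < z → ∀ a : ℝ,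
      AsianOption.bridgeF σ W v a ω = z ↔ a = AsianOption.implicitA σ W v z ω) ∧
    -- the expectation that defines `q(v, z)` is finite
    (∀ z : ℝ, 0 < z → Integrable (AsianOption.densityIntegrand σ W v z) P) ∧
    -- the density is `q(v, z)` for `z > 0` and `0` for `z ≤ 0`
    pdf (AsianOption.expFunctional σ W v) P volume =ᵐ[volume]
      (Set.Ioi (0 : ℝ)).indicator
        (fun z => ENNReal.ofReal (AsianOption.densityQ P σ W v z)) := by
  have hW0 := hW.toIsPreBrownianReal
  -- Everything is proved for a version with all paths continuous. Indistinguishability, rather than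
  -- equality at each time separately, is needed because the functionals see the whole path.
  obtain ⟨W', hm, hc, hWW'⟩ :=
    AsianOption.exists_measurable_continuous_modification hW0.aemeasurable hW.cont
  have hW' : IsPreBrownianReal W' P := hW0.congr fun t ↦ hWW'.mono fun ω h ↦ h t
  have hpath : ∀ᵐ ω ∂P,
      (AsianOption.bridgePath W · ω) = (AsianOption.bridgePath W' · ω) ∧ W 1 ω = W' 1 ω := by
    filter_upwards [hWW'] with ω h
    exact ⟨funext fun u ↦ by simp only [AsianOption.bridgePath, h], h 1⟩
  have hη : AsianOption.expFunctional σ W v =ᵐ[P]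
      fun ω ↦ AsianOption.pathF σ (AsianOption.bridgePath W' · ω) v (W' 1 ω) := by
    filter_upwards [hpath] with ω h
    rw [AsianOption.expFunctional_eq_pathF W ω hv₀.le hv₁, h.1, h.2]
  have h1 : W 1 =ᵐ[P] W' 1 := hpath.mono fun ω h ↦ h.2
  have hF (a : ℝ) : AsianOption.bridgeF σ W v a =ᵐ[P]
      fun ω ↦ AsianOption.pathF σ (AsianOption.bridgePath W' · ω) v a := by
    filter_upwards [hpath] with ω h
    rw [AsianOption.bridgeF_eq_pathF W ω hv₀.le hv₁, h.1]
  have hD (z : ℝ) : AsianOption.densityIntegrand σ W v z =ᵐ[P]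
      fun ω ↦ AsianOption.pathDensity σ (AsianOption.bridgePath W' · ω) v z := by
    filter_upwards [hpath] with ω h
    rw [AsianOption.densityIntegrand_eq_pathDensity W ω hv₀.le hv₁, h.1]
  have hZc (ω : Ω) : Continuous (AsianOption.bridgePath W' · ω) :=
    AsianOption.continuous_bridgePath (hc ω)
  have hZ := AsianOption.measurable_bridgePath hm
  have hind := AsianOption.indepFun_eval_one_bridgePath hW' hm
  have hI (z : ℝ) (hz : 0 < z) : Integrable
      (fun ω ↦ AsianOption.pathDensity σ (AsianOption.bridgePath W' · ω) v z) P :=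
    AsianOption.integrable_pathDensity hZc hZ hσ hv₀ hv₁
      (AsianOption.integrable_integral_exp_bridgePath hW' hm hc (2 * σ) hv₀.le) hz
  have hmap := AsianOption.map_pathF_eq_withDensity (hW'.hasLaw_eval 1) (hm 1) hZc hZ hind
    hσ hv₀ hI
  have hq : (fun z ↦ ∫ ω, AsianOption.pathDensity σ (AsianOption.bridgePath W' · ω) v z ∂P) =
      AsianOption.densityQ P σ W v :=
    funext fun z ↦ (integral_congr_ae (hD z)).symm
  have hηm : AEMeasurable (AsianOption.expFunctional σ W v) P :=
    ⟨_, (AsianOption.measurable_uncurry_pathF hZc hZ hv₀).comp ((hm 1).prodMk measurable_id), hη⟩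
  have hqm : Measurable ((Set.Ioi (0 : ℝ)).indicator
      fun z ↦ ENNReal.ofReal (AsianOption.densityQ P σ W v z)) := by
    rw [← hq]
    exact ((AsianOption.measurable_uncurry_pathDensity hZc hZ hσ
      hv₀).stronglyMeasurable.integral_prod_right').measurable.ennreal_ofReal.indicator
        measurableSet_Ioi
  have hlaw : P.map (AsianOption.expFunctional σ W v) = volume.withDensity
      ((Set.Ioi (0 : ℝ)).indicator
        fun z ↦ ENNReal.ofReal (AsianOption.densityQ P σ W v z)) := by
    rw [Measure.map_congr hη, hmap, ← hq]
  have hpdf : HasPDF (AsianOption.expFunctional σ W v) P volume :=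
    hasPDF_of_map_eq_withDensity hηm _ hqm.aemeasurable hlaw
  refine ⟨hpdf, ?_, ?_, ?_, fun z hz ↦ (hI z hz).congr (hD z).symm,
    (pdf.eq_of_map_eq_withDensity _ hqm.aemeasurable).1 hlaw⟩
  · rw [condDistrib_congr hη h1, Measure.map_congr h1]
    filter_upwards [AsianOption.condDistrib_pathF_ae_eq (σ := σ) (hm 1) hZc hZ hind hv₀] with a ha
    rw [ha, Measure.map_congr (hF a)]
  · filter_upwards [hpath] with ω h a
    simp only [AsianOption.bridgeF_eq_pathF W ω hv₀.le hv₁,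
      AsianOption.bridgeK_eq_pathK W ω hv₀.le hv₁, h.1]
    exact ⟨AsianOption.hasDerivAt_pathF hσ hv₀ (hZc ω) a,
      AsianOption.pathK_pos hσ hv₀ (hZc ω) a⟩
  · filter_upwards [hpath] with ω h z hz a
    rw [AsianOption.bridgeF_eq_pathF W ω hv₀.le hv₁,
      AsianOption.implicitA_eq_pathA W ω hv₀.le hv₁, h.1]
    exact AsianOption.pathF_eq_iff hσ hv₀ (hZc ω) hz a
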